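/- **Standing assumptions.** Let $x_0\in(0,1)$, let $a,b:[0,1]\to[0,\infty)$ satisfy $a(x_0)=b(x_0)=0$ and $a,b>0$ on $[0,1]\setminus\{x_0\}$, and let $K_1,K_2\in(0,2)$ be such that $(x-x_0)a'\le K_1a$ and $(x-x_0)b'\le K_2b$ a.e. in $[0,1]$. Call $a$ weakly degenerate if $K_1\in(0,1)$ and $a\in W^{1,1}(0,1)$, and strongly degenerate if $K_1\in[1,2)$ and $a\in W^{1,\infty}(0,1)$; likewise $b$ with $K_2$. (Sobolev functions of one variable are identified with their continuous representatives.) Assume that one of the following holds: 1. $a,b$ are weakly degenerate and $K_1+K_2<1$; 2. $a,b$ are weakly degenerate, $1\le K_1+K_2\le2$, and there are $c_1,c_2>0$ with $|x-x_0|^{K_1}\ge c_1a(x)$ and $|x-x_0|^{K_2}\ge c_2b(x)$ for all $x\in[0,1]$; 3. one of $a,b$ is weakly and the other strongly degenerate, $K_1+K_2\le2$, and there are $c_1,c_2>0$ as in 2; 4. $a,b$ are strongly degenerate with $K_1=K_2=1$. If $a$ is weakly degenerate, assume moreover that there are $\mathfrak g\in L^\infty_{\rm loc}([0,1]\setminus\{x_0\})$,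 $\mathfrak h\in W^{1,\infty}_{\rm loc}([0,1]\setminus\{x_0\};L^\infty(0,1))$ and constants $\mathfrak g_0,\mathfrak h_0>0$ with $\mathfrak g\ge\mathfrak g_0$ and $$\frac{a'(x)}{2\sqrt{a(x)}}\Big(\int_x^B\mathfrak g(t)\,dt+\mathfrak h_0\Big)+\sqrt{a(x)}\,\mathfrak g(x)=\mathfrak h(x,B)$$ for a.e. $x,B\in[0,1]$ with $x<B<x_0$ or $x_0<x<B$. **The adjoint problem.** Let $T>0$ and $\lambda\in\mathbb R$, and let $B$ denote either Dirichlet ($Bu=u$) or Neumann ($Bu=u_x$) boundary conditions. Let $L^2_{1/a}(0,1)=\{u\in L^2(0,1):\int_0^1u^2/a\,dx<\infty\}$ with norm $(\int_0^1u^2/a\,dx)^{1/2}$, let $Au=au''+\frac{\lambda}{b}u$, and let $$D(A)=\{u\in H^1(0,1)\cap L^2_{1/a}(0,1):\ u'\in H^1(0,1),\ Au\in L^2_{1/a}(0,1),\ Bu(0)=Bu(1)=0\},$$ $$D(A^2)=\{u\in D(A):Au\in D(A)\}.$$ A solution of the adjoint problem $$(P)\qquad v_t+av_{xx}+\frac{\lambda}{b}v=0\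 \text{ in }(0,T)\times(0,1),\qquad Bv(t,0)=Bv(t,1)=0,\qquad v(T,\cdot)\in D(A^2),$$ is a function $v\in C^1([0,T];L^2_{1/a}(0,1))$ with $v(T,\cdot)\in D(A^2)$ such that for every $t\in[0,T]$ one has $v(t,\cdot)\in H^1(0,1)$ and $v_x(t,\cdot)\in H^1_{\rm loc}([0,1]\setminus\{x_0\})$, the boundary conditions hold, and the equation holds a.e. in $(0,1)$. (In particular, every $v\in C^1([0,T];L^2_{1/a}(0,1))$ with $v(t)\in D(A)$ and $v_t+Av=0$ on $[0,T]$ and $v(T)\in D(A^2)$ is a solution.) **Proposition (Caccioppoli's inequality).** Let $\omega'=(\alpha',\beta')$ and $\omega=(\alpha,\beta)$ be open intervals with $\omega'\subset\subset\omega\subset(0,1)$ and $x_0\notin\overline\omega$, where $\omega'\subset\subset\omega$ means $\alpha<\alpha'<\beta'<\beta$. Let $\varphi(t,x)=\Theta(t)\Upsilon(x)$, where $$\Theta(t)=\frac1{[t(T-t)]^4},\qquad \Upsilon\in C([0,1],(-\infty,0))\cap C^1([0,1]\setminus\{x_0\},(-\infty,0)),\qquad |\Upsilon_x|\le\frac{c}{\sqrt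 a}\ \text{ in }[0,1]\setminus\{x_0\}$$ for some constant $c$. Then there are positive constants $C$, $C'$ and $s_0$ such that every solution $v$ of $(P)$ satisfies, for all $s\ge s_0$, $$\int_0^T\!\!\int_{\omega'}(v_x)^2e^{2s\varphi}\,dx\,dt\ \le\ C\int_0^T\!\!\int_\omega v^2\,dx\,dt\ \le\ C'\int_0^T\!\!\int_\omega \frac{v^2}{a}\,dx\,dt .$$ -/

import Mathlib

open MeasureTheory Set Filter
open scoped ENNReal

namespace Caccioppoli

/-- `u` belongs to `W^{1,p}(c,d)` with values in the Banach space `E`, and `u'` is its weak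
derivative. As usual in dimension one, `u` denotes the continuous representative on `[c,d]`,
that is, `u' ∈ L^p(c,d)` and `u` is a primitive of `u'`. Intended for `1 ≤ p` and `c ≤ d`. -/
def HasSobolevDeriv {E : Type*} [NormedAddCommGroup E] [NormedSpace ℝ E]
    (p : ℝ≥0∞) (c d : ℝ) (u u' : ℝ → E) : Prop :=
  MemLp u' p (volume.restrict (Ioo c d)) ∧
    ∀ x ∈ Icc c d, ∀ y ∈ Icc c d, u y - u x = ∫ t in x..y, u' t

/-- `a` vanishes at `x₀`, is positive on `[0,1] \ {x₀}`, lies in `W^{1,p}(0,1)`, and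
`(x - x₀) a' ≤ K a` a.e. -/
def Degenerate (p : ℝ≥0∞) (x₀ K : ℝ) (a : ℝ → ℝ) : Prop :=
  a x₀ = 0 ∧ (∀ x ∈ Icc (0 : ℝ) 1, x ≠ x₀ → 0 < a x) ∧
    ∃ a' : ℝ → ℝ, HasSobolevDeriv p 0 1 a a' ∧
      ∀ᵐ x ∂(volume.restrict (Icc (0 : ℝ) 1)), (x - x₀) * a' x ≤ K * a x

/-- Weak degeneracy at `x₀` with exponent `K ∈ (0,1)`. -/
def WeaklyDegenerate (x₀ K : ℝ) (a : ℝ → ℝ) : Prop :=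
  0 < K ∧ K < 1 ∧ Degenerate 1 x₀ K a

/-- Strong degeneracy at `x₀` with exponent `K ∈ [1,2)`. -/
def StronglyDegenerate (x₀ K : ℝ) (a : ℝ → ℝ) : Prop :=
  1 ≤ K ∧ K < 2 ∧ Degenerate ∞ x₀ K a

/-- Double weakly degenerate case. -/
def WWD (x₀ K₁ K₂ : ℝ) (a b : ℝ → ℝ) : Prop :=
  WeaklyDegenerate x₀ K₁ a ∧ WeaklyDegenerate x₀ K₂ b

/-- Double strongly degenerate case. -/
def SSD (x₀ K₁ K₂ : ℝ) (a b : ℝ → ℝ) : Prop :=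
  StronglyDegenerate x₀ K₁ a ∧ StronglyDegenerate x₀ K₂ b

/-- Weakly strongly degenerate case. -/
def WSD (x₀ K₁ K₂ : ℝ) (a b : ℝ → ℝ) : Prop :=
  WeaklyDegenerate x₀ K₁ a ∧ StronglyDegenerate x₀ K₂ b

/-- Strongly weakly degenerate case. -/
def SWD (x₀ K₁ K₂ : ℝ) (a b : ℝ → ℝ) : Prop :=
  StronglyDegenerate x₀ K₁ a ∧ WeaklyDegenerate x₀ K₂ b

/-- There are `c₁, c₂ > 0` with `|x - x₀|^K₁ ≥ c₁ a` and `|x - x₀|^K₂ ≥ c₂ b` on `[0,1]`. -/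
def PowerBound (x₀ K₁ K₂ : ℝ) (a b : ℝ → ℝ) : Prop :=
  ∃ c₁ c₂ : ℝ, 0 < c₁ ∧ 0 < c₂ ∧
    ∀ x ∈ Icc (0 : ℝ) 1, c₁ * a x ≤ |x - x₀| ^ K₁ ∧ c₂ * b x ≤ |x - x₀| ^ K₂

/-- The four admissible combinations of degeneracies. -/
def Admissible (x₀ K₁ K₂ : ℝ) (a b : ℝ → ℝ) : Prop :=
  (WWD x₀ K₁ K₂ a b ∧ K₁ + K₂ < 1) ∨
  (WWD x₀ K₁ K₂ a b ∧ 1 ≤ K₁ + K₂ ∧ K₁ + K₂ ≤ 2 ∧ PowerBound x₀ K₁ K₂ a b) ∨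
  ((WSD x₀ K₁ K₂ a b ∨ SWD x₀ K₁ K₂ a b) ∧ K₁ + K₂ ≤ 2 ∧ PowerBound x₀ K₁ K₂ a b) ∨
  (SSD x₀ K₁ K₂ a b ∧ K₁ = 1 ∧ K₂ = 1)

/-- There are `g ∈ L^∞_loc([0,1] \ {x₀})`, `h ∈ W^{1,∞}_loc([0,1] \ {x₀}; L^∞(0,1))` and
constants `g₀, h₀ > 0` with `g ≥ g₀` and
`a'(x) / (2 √a(x)) * (∫_x^B g + h₀) + √a(x) * g(x) = h(x,B)` for a.e. `x, B`
with `x < B < x₀` or `x₀ < x < B`. -/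
def WeightIdentity (x₀ : ℝ) (a : ℝ → ℝ) : Prop :=
  ∃ (a' g : ℝ → ℝ) (h : ℝ → Lp ℝ ∞ (volume.restrict (Ioo (0 : ℝ) 1))) (g₀ h₀ : ℝ),
    0 < g₀ ∧ 0 < h₀ ∧ HasSobolevDeriv 1 0 1 a a' ∧
    (∀ᵐ x ∂(volume.restrict (Ioo (0 : ℝ) 1)), g₀ ≤ g x) ∧
    (∀ c d : ℝ, c ≤ d → Icc c d ⊆ Icc (0 : ℝ) 1 \ {x₀} →
      MemLp g ∞ (volume.restrict (Ioo c d)) ∧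
      ∃ h' : ℝ → Lp ℝ ∞ (volume.restrict (Ioo (0 : ℝ) 1)), HasSobolevDeriv ∞ c d h h') ∧
    ∀ᵐ x ∂(volume.restrict (Ioo (0 : ℝ) 1)), ∀ᵐ B ∂(volume.restrict (Ioo (0 : ℝ) 1)),
      ((x < B ∧ B < x₀) ∨ (x₀ < x ∧ x < B)) →
        a' x / (2 * √(a x)) * ((∫ t in x..B, g t) + h₀) + √(a x) * g x = h x B

/-- The measure `dx / a` on `(0,1)`. The space `L²_{1/a}(0,1)` is `L²` of this measure; it is
contained in `L²(0,1)` because `a` is bounded. -/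
noncomputable def weightedMeasure (a : ℝ → ℝ) : Measure ℝ :=
  (volume.restrict (Ioo (0 : ℝ) 1)).withDensity fun x => ENNReal.ofReal (1 / a x)

/-- The two kinds of boundary conditions. -/
inductive BoundaryKind
  | dirichlet
  | neumann

/-- `Bu(0) = Bu(1) = 0`, for a function `u` with derivative `u'`. -/
def BoundaryKind.Holds : BoundaryKind → (ℝ → ℝ) → (ℝ → ℝ) → Prop
  | .dirichlet, u, _ => u 0 = 0 ∧ u 1 = 0
  | .neumann, _, u' => u' 0 = 0 ∧ u' 1 = 0

/-- `u ∈ D(A)` and `A u = w`, where `A u = a u'' + (lam / b) u` and `D(A)` consists of the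
`u ∈ H¹(0,1) ∩ L²_{1/a}(0,1)` such that `u' ∈ H¹(0,1)`, `A u ∈ L²_{1/a}(0,1)`, and the boundary
conditions hold. -/
def OperatorGraph (bc : BoundaryKind) (a b : ℝ → ℝ) (lam : ℝ) (u w : ℝ → ℝ) : Prop :=
  MemLp u 2 (weightedMeasure a) ∧ MemLp w 2 (weightedMeasure a) ∧
    ∃ u₁ u₂ : ℝ → ℝ, HasSobolevDeriv 2 0 1 u u₁ ∧ HasSobolevDeriv 2 0 1 u₁ u₂ ∧
      bc.Holds u u₁ ∧
      ∀ᵐ x ∂(volume.restrict (Ioo (0 : ℝ) 1)), w x = a x * u₂ x + lam / b x * u x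

/-- `u ∈ D(A²)`, that is, `u ∈ D(A)` and `A u ∈ D(A)`. -/
def MemDomainSq (bc : BoundaryKind) (a b : ℝ → ℝ) (lam : ℝ) (u : ℝ → ℝ) : Prop :=
  ∃ w z : ℝ → ℝ, OperatorGraph bc a b lam u w ∧ OperatorGraph bc a b lam w z

/-- `v` is a (strong) solution of the adjoint problem
`v_t + a v_xx + (lam / b) v = 0` in `(0,T) × (0,1)`, `Bv(0) = Bv(1) = 0`, `v(T) ∈ D(A²)`.
Here `v ∈ C¹([0,T]; L²_{1/a}(0,1))` (`V` is `v` as a curve in that space), and for every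
`t ∈ [0,T]` one has `v(t) ∈ H¹(0,1)` with derivative `v₁`, `v₁ ∈ H¹_loc([0,1] \ {x₀})` with
derivative `v₂`, the boundary conditions, and the equation a.e. in `(0,1)`.
In particular this covers every `v ∈ C¹([0,T]; L²_{1/a}(0,1))` with `v(t) ∈ D(A)`,
`v_t + A v = 0` on `[0,T]` and `v(T) ∈ D(A²)`. -/
def IsAdjointSolution (bc : BoundaryKind) (a b : ℝ → ℝ) (lam x₀ T : ℝ)
    (v : ℝ → ℝ → ℝ) : Prop :=
  (∃ V : ℝ → Lp ℝ 2 (weightedMeasure a), ContDiffOn ℝ 1 V (Icc 0 T) ∧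
    ∀ t ∈ Icc (0 : ℝ) T, V t =ᵐ[weightedMeasure a] v t ∧
      ∃ v₁ v₂ : ℝ → ℝ, HasSobolevDeriv 2 0 1 (v t) v₁ ∧
        (∀ c d : ℝ, c ≤ d → Icc c d ⊆ Icc (0 : ℝ) 1 \ {x₀} → HasSobolevDeriv 2 c d v₁ v₂) ∧
        bc.Holds (v t) v₁ ∧
        ⇑(derivWithin V (Icc 0 T) t : Lp ℝ 2 (weightedMeasure a)) =ᵐ[weightedMeasure a]
          fun x => -(a x * v₂ x + lam / b x * v t x)) ∧
  MemDomainSq bc a b lam (v T)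

/-- `Θ(t) = 1 / [t (T - t)]⁴`, for `0 < t < T`. -/
noncomputable def timeWeight (T t : ℝ) : ℝ := 1 / (t * (T - t)) ^ 4

end Caccioppoli

/-!
The closure of `ω = (α, β)` avoids `x₀`, so there `a` and `b` are continuous and bounded below by
positive constants, and the estimate is an interior one. Two choices keep it short.

* The equation is tested with `ξ² v / a` rather than `ξ² v`, that is, the energy is
  `p(t) = ∫ ξ² v² / a`, a bounded quadratic form on `L²_{1/a}`. Then
  `p' = -2 ∫ ξ² v (v_xx + lam / (a b) v)`, and integration by parts in `x` never differentiates `a`.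
  With `ξ(x) = (x - α) (β - x)`, which vanishes at `α` and `β`, this yields
  `∫ ξ² v_x² ≤ p' + C ∫_ω v²` at each time (`integral_cutoff_sq_mul_deriv_sq_le`).
* Since `Υ ≤ -m < 0`, the Carleman weight satisfies `exp (2 s φ) ≤ C t (T - t)` for all `s ≥ 1`
  (`exp_timeWeight_le`), so the weight `t (T - t)`, independent of `x` and `s`, suffices. It vanishes
  at `0` and `T`; hence `∫ t (T - t) p' = -∫ (T - 2 t) p`, which is at most a constant times
  `∫∫_ω v²` (`lintegral_mul_le_of_le_inner_derivWithin`).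

Together they give `IsAdjointSolution.lintegral_cutoff_sq_mul_deriv_sq_le`, and `ξ` is bounded below
on `ω'`. The second inequality of the theorem is the upper bound for `a` on `ω`.
-/

namespace Caccioppoli

/-! ### One-variable Sobolev functions -/

theorem HasSobolevDeriv.intervalIntegrable {p : ℝ≥0∞} {c d x y : ℝ} {u u' : ℝ → ℝ}
    (h : HasSobolevDeriv p c d u u') (hp : 1 ≤ p) (hx : x ∈ Icc c d) (hy : y ∈ Icc c d) :
    IntervalIntegrable u' volume x y := by
  have h1 : IntegrableOn u' (Icc c d) := by
    rw [integrableOn_Icc_iff_integrableOn_Ioo]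
    exact h.1.integrable hp
  rw [intervalIntegrable_iff]
  exact h1.mono_set (uIoc_subset_uIcc.trans (uIcc_subset_Icc hx hy))

theorem HasSobolevDeriv.mono {p : ℝ≥0∞} {c d c' d' : ℝ} {u u' : ℝ → ℝ}
    (h : HasSobolevDeriv p c d u u') (hc : c ≤ c') (hd : d' ≤ d) :
    HasSobolevDeriv p c' d' u u' :=
  ⟨h.1.mono_measure (Measure.restrict_mono (Ioo_subset_Ioo hc hd) le_rfl),
    fun x hx y hy => h.2 x (Icc_subset_Icc hc hd hx) y (Icc_subset_Icc hc hd hy)⟩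

theorem HasSobolevDeriv.absolutelyContinuousOnInterval {p : ℝ≥0∞} {c d : ℝ} {u u' : ℝ → ℝ}
    (h : HasSobolevDeriv p c d u u') (hp : 1 ≤ p) (hcd : c ≤ d) :
    AbsolutelyContinuousOnInterval u c d := by
  have hc : c ∈ Icc c d := left_mem_Icc.2 hcd
  have hd : d ∈ Icc c d := right_mem_Icc.2 hcd
  have h1 := (h.intervalIntegrable hp hc hd).absolutelyContinuousOnInterval_intervalIntegral
    (c := c) left_mem_uIcc
  have h2 : AbsolutelyContinuousOnInterval (fun _ : ℝ => u c) c d :=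
    contDiffOn_const.absolutelyContinuousOnInterval
  have h3 := h2.fun_add h1
  rw [absolutelyContinuousOnInterval_iff] at h3 ⊢
  intro ε hε
  obtain ⟨δ, hδ, H⟩ := h3 ε hε
  refine ⟨δ, hδ, fun E hE hlt => ?_⟩
  refine lt_of_eq_of_lt (Finset.sum_congr rfl fun i hi => ?_) (H E hE hlt)
  have hm := hE.1 i hi
  rw [uIcc_of_le hcd] at hm
  rw [← h.2 c hc _ hm.1, ← h.2 c hc _ hm.2]
  simp

theorem HasSobolevDeriv.continuousOn {p : ℝ≥0∞} {c d : ℝ} {u u' : ℝ → ℝ}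
    (h : HasSobolevDeriv p c d u u') (hp : 1 ≤ p) (hcd : c ≤ d) : ContinuousOn u (Icc c d) := by
  simpa [uIcc_of_le hcd] using (h.absolutelyContinuousOnInterval hp hcd).continuousOn

theorem HasSobolevDeriv.ae_hasDerivAt {p : ℝ≥0∞} {c d : ℝ} {u u' : ℝ → ℝ}
    (h : HasSobolevDeriv p c d u u') (hp : 1 ≤ p) (hcd : c ≤ d) :
    ∀ᵐ x, x ∈ Ioo c d → HasDerivAt u (u' x) x := by
  have hc : c ∈ Icc c d := left_mem_Icc.2 hcd
  have hd : d ∈ Icc c d := right_mem_Icc.2 hcd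
  filter_upwards [(h.intervalIntegrable hp hc hd).ae_hasDerivAt_integral] with x hx hxm
  have h1 := (hx (by rw [uIcc_of_le hcd]; exact Ioo_subset_Icc_self hxm) c
    left_mem_uIcc).const_add (u c)
  refine h1.congr_of_eventuallyEq ?_
  filter_upwards [isOpen_Ioo.mem_nhds hxm] with y hy
  rw [← h.2 c hc y (Ioo_subset_Icc_self hy)]
  ring

theorem HasSobolevDeriv.hasDerivAt_of_continuousOn {p : ℝ≥0∞} {c d x : ℝ} {u u' : ℝ → ℝ}
    (h : HasSobolevDeriv p c d u u') (hp : 1 ≤ p) (hu' : ContinuousOn u' (Icc c d))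
    (hx : x ∈ Ioo c d) : HasDerivAt u (u' x) x := by
  have hcd : c ≤ d := (hx.1.trans hx.2).le
  have hc : c ∈ Icc c d := left_mem_Icc.2 hcd
  have hnhds : Ioo c d ∈ nhds x := isOpen_Ioo.mem_nhds hx
  have hcont : ContinuousAt u' x := hu'.continuousAt (mem_of_superset hnhds Ioo_subset_Icc_self)
  have h1 := (intervalIntegral.integral_hasDerivAt_right
    (h.intervalIntegrable hp hc (Ioo_subset_Icc_self hx))
    ((hu'.mono Ioo_subset_Icc_self).stronglyMeasurableAtFilter isOpen_Ioo x hx) hcont).const_add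
      (u c)
  refine h1.congr_of_eventuallyEq ?_
  filter_upwards [hnhds] with y hy
  rw [← h.2 c hc y (Ioo_subset_Icc_self hy)]
  ring

/-! ### The localized energy identity on a fixed time slice -/

/-- The cutoff on `(α, β)`. It vanishes at both end points, which is all that integration by parts
on `[α, β]` requires. -/
def cutoff (α β x : ℝ) : ℝ := (x - α) * (β - x)

theorem continuous_cutoff (α β : ℝ) : Continuous (cutoff α β) := by
  unfold cutoff; fun_prop

theorem cutoff_nonneg {α β x : ℝ} (hx : x ∈ Ioo α β) : 0 ≤ cutoff α β x :=
  mul_nonneg (sub_nonneg.2 hx.1.le) (sub_nonneg.2 hx.2.le)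

theorem cutoff_le_one {α β x : ℝ} (hα : 0 ≤ α) (hβ : β ≤ 1) (hx : x ∈ Ioo α β) :
    cutoff α β x ≤ 1 :=
  mul_le_one₀ (by linarith [hx.2]) (sub_nonneg.2 hx.2.le) (by linarith [hx.1])

theorem hasDerivAt_cutoff (α β x : ℝ) : HasDerivAt (cutoff α β) (α + β - 2 * x) x := by
  have := ((hasDerivAt_id' x).sub_const α).fun_mul ((hasDerivAt_id' x).const_sub β)
  exact this.congr_deriv (by ring)

theorem integral_cutoff_sq_mul_mul_deriv {α β : ℝ} {u u₁ u₂ : ℝ → ℝ} (hαβ : α ≤ β)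
    (hu : HasSobolevDeriv 2 α β u u₁) (hu₁ : HasSobolevDeriv 2 α β u₁ u₂) :
    ∫ x in α..β, cutoff α β x ^ 2 * u x * u₂ x =
      -∫ x in α..β, (2 * cutoff α β x * (α + β - 2 * x) * u x * u₁ x
        + cutoff α β x ^ 2 * u₁ x ^ 2) := by
  have hξ : AbsolutelyContinuousOnInterval (fun x => cutoff α β x ^ 2) α β := by
    refine ContDiffOn.absolutelyContinuousOnInterval (ContDiff.contDiffOn ?_)
    unfold cutoff
    fun_prop
  have h1 := hξ.fun_mul (hu.absolutelyContinuousOnInterval one_le_two hαβ)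
  have h2 := h1.integral_mul_deriv_eq_deriv_mul (hu₁.absolutelyContinuousOnInterval one_le_two hαβ)
  have hne : ∀ᵐ x : ℝ, x ≠ β := by simp [ae_iff]
  have e1 : ∫ x in α..β, cutoff α β x ^ 2 * u x * deriv u₁ x =
      ∫ x in α..β, cutoff α β x ^ 2 * u x * u₂ x := by
    refine intervalIntegral.integral_congr_ae ?_
    filter_upwards [hu₁.ae_hasDerivAt one_le_two hαβ, hne] with x hx hxβ hxm
    rw [uIoc_of_le hαβ] at hxm
    rw [(hx ⟨hxm.1, lt_of_le_of_ne hxm.2 hxβ⟩).deriv]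
  have e2 : ∫ x in α..β, deriv (fun x => cutoff α β x ^ 2 * u x) x * u₁ x =
      ∫ x in α..β, (2 * cutoff α β x * (α + β - 2 * x) * u x * u₁ x
        + cutoff α β x ^ 2 * u₁ x ^ 2) := by
    refine intervalIntegral.integral_congr_ae ?_
    filter_upwards [hu.ae_hasDerivAt one_le_two hαβ, hne] with x hx hxβ hxm
    rw [uIoc_of_le hαβ] at hxm
    have h3 := ((hasDerivAt_cutoff α β x).fun_pow 2).fun_mul
      (hx ⟨hxm.1, lt_of_le_of_ne hxm.2 hxβ⟩)
    rw [h3.deriv]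
    ring
  rw [← e1, h2, e2]
  simp [cutoff]

/-- Caccioppoli estimate on a time slice. For a solution of the equation, the first integral on
the right is half the time derivative of `∫ ξ² u² / a`, where `ξ` is the cutoff. -/
theorem integral_cutoff_sq_mul_deriv_sq_le {α β Q : ℝ} {q u u₁ u₂ : ℝ → ℝ}
    (hα : 0 ≤ α) (hβ : β ≤ 1) (hαβ : α < β) (hq : ContinuousOn q (Icc α β))
    (hQ : ∀ x ∈ Ioo α β, |q x| ≤ Q)
    (hu : HasSobolevDeriv 2 α β u u₁) (hu₁ : HasSobolevDeriv 2 α β u₁ u₂) :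
    ∫ x in Ioo α β, cutoff α β x ^ 2 * u₁ x ^ 2 ≤
      2 * (∫ x in Ioo α β, cutoff α β x ^ 2 * u x * -(u₂ x + q x * u x)) +
        (4 + 2 * Q) * ∫ x in Ioo α β, u x ^ 2 := by
  have hle := hαβ.le
  have cu := hu.continuousOn one_le_two hle
  have cu₁ := hu₁.continuousOn one_le_two hle
  have cξ := (continuous_cutoff α β).continuousOn (s := Icc α β)
  have hI : ∀ {f : ℝ → ℝ}, ContinuousOn f (Icc α β) → IntegrableOn f (Ioo α β) := fun hf =>
    hf.integrableOn_Icc.mono_set Ioo_subset_Icc_self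
  have i₂ : IntegrableOn (fun x => cutoff α β x ^ 2 * u x * u₂ x) (Ioo α β) := by
    have : IntegrableOn u₂ (Icc α β) := by
      rw [integrableOn_Icc_iff_integrableOn_Ioo]
      exact hu₁.1.integrable one_le_two
    exact (this.continuousOn_mul ((cξ.pow 2).mul cu) isCompact_Icc).mono_set Ioo_subset_Icc_self
  have iq : IntegrableOn (fun x => cutoff α β x ^ 2 * (q x * u x ^ 2)) (Ioo α β) :=
    hI ((cξ.pow 2).mul (hq.mul (cu.pow 2)))
  have ig : IntegrableOn (fun x => 2 * cutoff α β x * (α + β - 2 * x) * u x * u₁ x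
        + cutoff α β x ^ 2 * u₁ x ^ 2) (Ioo α β) :=
    hI (by fun_prop)
  have hparts := integral_cutoff_sq_mul_mul_deriv hle hu hu₁
  simp only [intervalIntegral.integral_of_le hle, integral_Ioc_eq_integral_Ioo] at hparts
  have e1 : ∫ x in Ioo α β, cutoff α β x ^ 2 * u x * -(u₂ x + q x * u x) =
      (∫ x in Ioo α β, (2 * cutoff α β x * (α + β - 2 * x) * u x * u₁ x
        + cutoff α β x ^ 2 * u₁ x ^ 2)) - ∫ x in Ioo α β, cutoff α β x ^ 2 * (q x * u x ^ 2) := by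
    rw [← neg_eq_iff_eq_neg] at hparts
    have i₃ : IntegrableOn (fun x => -(cutoff α β x ^ 2 * u x * u₂ x)) (Ioo α β) := i₂.neg
    rw [← hparts, ← integral_neg, ← integral_sub i₃ iq]
    congr 1 with x
    ring
  have i0 : IntegrableOn (fun x => u x ^ 2) (Ioo α β) := hI (cu.pow 2)
  have ij : IntegrableOn (fun x => 2 * (2 * cutoff α β x * (α + β - 2 * x) * u x * u₁ x
        + cutoff α β x ^ 2 * u₁ x ^ 2 - cutoff α β x ^ 2 * (q x * u x ^ 2))) (Ioo α β) :=
    (ig.sub iq).const_mul 2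
  rw [e1, ← integral_sub ig iq, ← integral_const_mul, ← integral_const_mul,
    ← integral_add ij (i0.const_mul _)]
  refine setIntegral_mono_on (hI (by fun_prop)) (ij.add (i0.const_mul _))
    measurableSet_Ioo fun x hx => ?_
  have hx1 := cutoff_le_one hα hβ hx
  have hx0 := cutoff_nonneg hx
  have hd : (α + β - 2 * x) ^ 2 ≤ 1 := by
    rw [sq_le_one_iff_abs_le_one, abs_le]
    constructor <;> linarith [hx.1, hx.2]
  have hQ1 := hQ x hx
  have hξ1 : cutoff α β x ^ 2 ≤ 1 := pow_le_one₀ hx0 hx1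
  have hξq : cutoff α β x ^ 2 * q x ≤ Q := by
    calc cutoff α β x ^ 2 * q x ≤ cutoff α β x ^ 2 * |q x| := by gcongr; exact le_abs_self _
      _ ≤ 1 * |q x| := by gcongr
      _ ≤ Q := by rwa [one_mul]
  have h4 : cutoff α β x ^ 2 * q x * u x ^ 2 ≤ Q * u x ^ 2 := by gcongr
  have h5 : (α + β - 2 * x) ^ 2 * u x ^ 2 ≤ 1 * u x ^ 2 := by gcongr
  linarith [sq_nonneg (cutoff α β x * u₁ x + 2 * (α + β - 2 * x) * u x)]

/-! ### Multiplication operators on the weighted space -/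

/-- Multiplication by an essentially bounded function is a bounded operator on `L²`. -/
theorem exists_multiplication {μ : Measure ℝ} {k : ℝ → ℝ} (hk : MemLp k ∞ μ) :
    ∃ M : Lp ℝ 2 μ →L[ℝ] Lp ℝ 2 μ, ∀ f : Lp ℝ 2 μ, M f =ᵐ[μ] fun x => k x * f x := by
  refine ⟨(ContinuousLinearMap.mul ℝ ℝ).holderL μ ∞ 2 2 (hk.toLp k), fun f => ?_⟩
  filter_upwards [(ContinuousLinearMap.mul ℝ ℝ).coeFn_holder (r := 2) (hk.toLp k) f,
    hk.coeFn_toLp] with x h1 h2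
  rw [← h2]
  exact h1

theorem inner_multiplication {μ : Measure ℝ} {k f g : ℝ → ℝ} {M : Lp ℝ 2 μ →L[ℝ] Lp ℝ 2 μ}
    (hM : ∀ f : Lp ℝ 2 μ, M f =ᵐ[μ] fun x => k x * f x) {F G : Lp ℝ 2 μ}
    (hF : F =ᵐ[μ] f) (hG : G =ᵐ[μ] g) : inner ℝ F (M G) = ∫ x, k x * (f x * g x) ∂μ := by
  rw [L2.inner_def]
  refine integral_congr_ae ?_
  filter_upwards [hM G, hF, hG] with x h1 h2 h3
  rw [h1, h2, h3]
  simp only [RCLike.inner_apply, conj_trivial]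
  ring

theorem memLp_top_indicator_Ioo {μ : Measure ℝ} {α β : ℝ} {ρ : ℝ → ℝ}
    (hρ : ContinuousOn ρ (Icc α β)) : MemLp ((Ioo α β).indicator ρ) ∞ μ := by
  obtain ⟨C, hC⟩ := isCompact_Icc.exists_bound_of_continuousOn hρ
  refine memLp_top_of_bound ?_ (max C 0) (Eventually.of_forall fun x => ?_)
  · rw [aestronglyMeasurable_indicator_iff measurableSet_Ioo]
    exact (hρ.mono Ioo_subset_Icc_self).aestronglyMeasurable measurableSet_Ioo
  · by_cases hx : x ∈ Ioo α β
    · rw [indicator_of_mem hx]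
      exact (hC x (Ioo_subset_Icc_self hx)).trans (le_max_left _ _)
    · simp [indicator_of_notMem hx]

theorem aemeasurable_ofReal_one_div {a : ℝ → ℝ} (ha : ContinuousOn a (Icc 0 1)) :
    AEMeasurable (fun x => ENNReal.ofReal (1 / a x)) (volume.restrict (Ioo (0 : ℝ) 1)) := by
  have h := (ha.mono Ioo_subset_Icc_self).aemeasurable (μ := volume) measurableSet_Ioo
  exact (h.const_div 1).ennreal_ofReal

theorem integral_weightedMeasure_indicator {α β : ℝ} {a ρ f : ℝ → ℝ}
    (ha : ContinuousOn a (Icc 0 1)) (hα : 0 ≤ α) (hβ : β ≤ 1) (hpos : ∀ x ∈ Ioo α β, 0 < a x) :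
    ∫ x, (Ioo α β).indicator ρ x * f x ∂weightedMeasure a =
      ∫ x in Ioo α β, ρ x * f x * (1 / a x) := by
  have hsub : Ioo α β ⊆ Ioo 0 1 := Ioo_subset_Ioo hα hβ
  rw [weightedMeasure, integral_withDensity_eq_integral_toReal_smul₀
    (aemeasurable_ofReal_one_div ha) (by simp)]
  have h1 : ∀ x, (ENNReal.ofReal (1 / a x)).toReal • ((Ioo α β).indicator ρ x * f x) =
      (Ioo α β).indicator (fun x => ρ x * f x * (1 / a x)) x := by
    intro x
    by_cases hx : x ∈ Ioo α β
    · have := hpos x hx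
      rw [indicator_of_mem hx, indicator_of_mem hx, ENNReal.toReal_ofReal (by positivity),
        smul_eq_mul]
      ring
    · simp [indicator_of_notMem hx]
  simp_rw [h1]
  rw [integral_indicator measurableSet_Ioo, Measure.restrict_restrict measurableSet_Ioo,
    inter_eq_left.2 hsub]

/-! ### The energy estimate in time -/

section Time

variable {H : Type*} [NormedAddCommGroup H] [InnerProductSpace ℝ H]

/-- Integration by parts against `t (T - t)`: by symmetry of `M`, twice the inner product on the
left is the derivative of `⟪V, M V⟫`. -/
theorem integral_mul_inner_derivWithin {V : ℝ → H} {M : H →L[ℝ] H} {T : ℝ} (hT : 0 < T)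
    (hM : ∀ F G : H, inner ℝ F (M G) = inner ℝ G (M F)) (hV : ContDiffOn ℝ 1 V (Icc 0 T)) :
    ∫ t in (0 : ℝ)..T, t * (T - t) * (2 * inner ℝ (derivWithin V (Icc 0 T) t) (M (V t))) =
      -∫ t in (0 : ℝ)..T, (T - 2 * t) * inner ℝ (V t) (M (V t)) := by
  have cV := hV.continuousOn
  have cV' := hV.continuousOn_derivWithin (uniqueDiffOn_Icc hT) le_rfl
  have cM : ContinuousOn (fun t => M (V t)) (Icc 0 T) := M.continuous.comp_continuousOn cV
  have c1 : ContinuousOn (fun t => (T - 2 * t) * inner ℝ (V t) (M (V t))) (Icc 0 T) :=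
    (by fun_prop : Continuous fun t : ℝ => T - 2 * t).continuousOn.mul (cV.inner cM)
  have c2 : ContinuousOn (fun t => t * (T - t) *
      (2 * inner ℝ (derivWithin V (Icc 0 T) t) (M (V t)))) (Icc 0 T) :=
    (by fun_prop : Continuous fun t : ℝ => t * (T - t)).continuousOn.mul
      (continuousOn_const.mul (cV'.inner cM))
  have i1 := c1.intervalIntegrable_of_Icc hT.le (μ := volume)
  have i2 := c2.intervalIntegrable_of_Icc hT.le (μ := volume)
  have key := intervalIntegral.integral_eq_sub_of_hasDerivAt_of_le hT.le
    (f := fun t => t * (T - t) * inner ℝ (V t) (M (V t)))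
    (f' := fun t => (T - 2 * t) * inner ℝ (V t) (M (V t)) + t * (T - t) *
      (2 * inner ℝ (derivWithin V (Icc 0 T) t) (M (V t))))
    ((by fun_prop : Continuous fun t : ℝ => t * (T - t)).continuousOn.mul (cV.inner cM))
    (fun t ht => by
      have hd : HasDerivAt V (derivWithin V (Icc 0 T) t) t :=
        ((hV.differentiableOn one_ne_zero) t (Ioo_subset_Icc_self ht)).hasDerivWithinAt.hasDerivAt
          (Icc_mem_nhds ht.1 ht.2)
      have hw := (hasDerivAt_id' t).fun_mul ((hasDerivAt_id' t).const_sub T)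
      refine (hw.fun_mul (hd.inner ℝ (M.hasFDerivAt.comp_hasDerivAt t hd))).congr_deriv ?_
      simp only [Function.comp_apply]
      rw [hM (V t) (derivWithin V (Icc 0 T) t)]
      ring)
    (i1.add i2)
  rw [intervalIntegral.integral_add i1 i2] at key
  simp only [sub_self, mul_zero, zero_mul] at key
  linarith

/-- The weight `t (T - t)` vanishes at both ends of `[0, T]`, so that integrating the time
derivative of the energy `⟪V, M V⟫` against it leaves only terms controlled by `⟪V, P V⟫`. -/
theorem lintegral_mul_le_of_le_inner_derivWithin {V : ℝ → H} {M P : H →L[ℝ] H}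
    {T C₀ C₁ : ℝ} {J : ℝ → ℝ} (hT : 0 < T) (hC₀ : 0 ≤ C₀)
    (hM : ∀ F G : H, inner ℝ F (M G) = inner ℝ G (M F)) (hV : ContDiffOn ℝ 1 V (Icc 0 T))
    (hJ₀ : ∀ t ∈ Icc 0 T, 0 ≤ J t)
    (hJ : ∀ t ∈ Icc 0 T, J t ≤ 2 * inner ℝ (derivWithin V (Icc 0 T) t) (M (V t))
      + C₀ * inner ℝ (V t) (P (V t)))
    (hM₀ : ∀ t ∈ Icc 0 T, 0 ≤ inner ℝ (V t) (M (V t)))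
    (hMP : ∀ t ∈ Icc 0 T, inner ℝ (V t) (M (V t)) ≤ C₁ * inner ℝ (V t) (P (V t)))
    (hP : ∀ t ∈ Icc 0 T, 0 ≤ inner ℝ (V t) (P (V t))) :
    ∫⁻ t in Ioo 0 T, ENNReal.ofReal (t * (T - t) * J t) ≤
      ENNReal.ofReal (T * C₁ + T ^ 2 * C₀) *
        ∫⁻ t in Ioo 0 T, ENNReal.ofReal (inner ℝ (V t) (P (V t))) := by
  have cV := hV.continuousOn
  have cV' := hV.continuousOn_derivWithin (uniqueDiffOn_Icc hT) le_rfl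
  have cM : ContinuousOn (fun t => M (V t)) (Icc 0 T) := M.continuous.comp_continuousOn cV
  have cP : ContinuousOn (fun t => P (V t)) (Icc 0 T) := P.continuous.comp_continuousOn cV
  have cN : ContinuousOn (fun t => inner ℝ (V t) (P (V t))) (Icc 0 T) := cV.inner cP
  have cw : ContinuousOn (fun t : ℝ => t * (T - t)) (Icc 0 T) := by fun_prop
  have cD : ContinuousOn (fun t => t * (T - t) *
      (2 * inner ℝ (derivWithin V (Icc 0 T) t) (M (V t)))) (Icc 0 T) :=
    cw.mul (continuousOn_const.mul (cV'.inner cM))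
  have cp : ContinuousOn (fun t => (T - 2 * t) * inner ℝ (V t) (M (V t))) (Icc 0 T) :=
    (by fun_prop : Continuous fun t : ℝ => T - 2 * t).continuousOn.mul (cV.inner cM)
  have cwN : ContinuousOn (fun t => t * (T - t) * (C₀ * inner ℝ (V t) (P (V t)))) (Icc 0 T) :=
    cw.mul (continuousOn_const.mul cN)
  have cE := cD.add cwN
  have hw : ∀ t ∈ Icc 0 T, 0 ≤ t * (T - t) := fun t ht =>
    mul_nonneg ht.1 (sub_nonneg.2 ht.2)
  have hle : ∀ t ∈ Icc 0 T, t * (T - t) * J t ≤ t * (T - t) *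
      (2 * inner ℝ (derivWithin V (Icc 0 T) t) (M (V t))) +
        t * (T - t) * (C₀ * inner ℝ (V t) (P (V t))) := fun t ht => by
    rw [← mul_add]
    exact mul_le_mul_of_nonneg_left (hJ t ht) (hw t ht)
  have hI : ∀ {f : ℝ → ℝ}, ContinuousOn f (Icc 0 T) → IntegrableOn f (Ioo 0 T) := fun hf =>
    hf.integrableOn_Icc.mono_set Ioo_subset_Icc_self
  calc ∫⁻ t in Ioo 0 T, ENNReal.ofReal (t * (T - t) * J t)
      ≤ ∫⁻ t in Ioo 0 T, ENNReal.ofReal (t * (T - t) *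
          (2 * inner ℝ (derivWithin V (Icc 0 T) t) (M (V t))) +
            t * (T - t) * (C₀ * inner ℝ (V t) (P (V t)))) :=
        setLIntegral_mono' measurableSet_Ioo fun t ht =>
          ENNReal.ofReal_le_ofReal (hle t (Ioo_subset_Icc_self ht))
    _ = ENNReal.ofReal (∫ t in Ioo 0 T, (t * (T - t) *
          (2 * inner ℝ (derivWithin V (Icc 0 T) t) (M (V t))) +
            t * (T - t) * (C₀ * inner ℝ (V t) (P (V t))))) := by
        refine (ofReal_integral_eq_lintegral_ofReal (hI cE) ?_).symm
        filter_upwards [ae_restrict_mem measurableSet_Ioo] with t ht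
        have ht' := Ioo_subset_Icc_self ht
        exact (mul_nonneg (hw t ht') (hJ₀ t ht')).trans (hle t ht')
    _ ≤ ENNReal.ofReal ((T * C₁ + T ^ 2 * C₀) *
          ∫ t in Ioo 0 T, inner ℝ (V t) (P (V t))) := by
        refine ENNReal.ofReal_le_ofReal ?_
        have h1 := integral_mul_inner_derivWithin hT hM hV
        simp only [intervalIntegral.integral_of_le hT.le, integral_Ioc_eq_integral_Ioo] at h1
        rw [integral_add (hI cD) (hI cwN), h1, ← integral_neg, ← integral_add ?_ (hI cwN),
          ← integral_const_mul]
        · refine setIntegral_mono_on (hI (cp.neg.add cwN)) ((hI cN).const_mul _)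
            measurableSet_Ioo fun t ht => ?_
          have ht' := Ioo_subset_Icc_self ht
          have h2 : -((T - 2 * t) * inner ℝ (V t) (M (V t))) ≤
              T * (C₁ * inner ℝ (V t) (P (V t))) := by
            rw [← neg_mul]
            calc -(T - 2 * t) * inner ℝ (V t) (M (V t)) ≤ T * inner ℝ (V t) (M (V t)) :=
                  mul_le_mul_of_nonneg_right (by linarith [ht.2]) (hM₀ t ht')
              _ ≤ _ := mul_le_mul_of_nonneg_left (hMP t ht') hT.le
          have h3 : t * (T - t) * (C₀ * inner ℝ (V t) (P (V t))) ≤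
              T ^ 2 * (C₀ * inner ℝ (V t) (P (V t))) := by
            refine mul_le_mul_of_nonneg_right ?_ (mul_nonneg hC₀ (hP t ht'))
            rw [sq]
            exact mul_le_mul ht.2.le (by linarith [ht.1]) (by linarith [ht.2]) hT.le
          linarith
        · exact hI cp.neg
    _ = _ := by
        have hN₀ : 0 ≤ᵐ[volume.restrict (Ioo 0 T)] fun t => inner ℝ (V t) (P (V t)) := by
          filter_upwards [ae_restrict_mem measurableSet_Ioo] with t ht
          exact hP t (Ioo_subset_Icc_self ht)
        rw [ENNReal.ofReal_mul' (integral_nonneg_of_ae hN₀),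
          ofReal_integral_eq_lintegral_ofReal (hI cN) hN₀]

end Time

/-! ### The weight and the coefficients -/

/-- Since `e^{-y} ≤ 1 / y`, the exponential weight is bounded by `(t (T - t))⁴ / (2 m)`, uniformly
in `s ≥ 1`. -/
theorem exp_timeWeight_le {T t s m y : ℝ} (hm : 0 < m) (hy : y ≤ -m) (hs : 1 ≤ s)
    (ht : t ∈ Ioo 0 T) :
    Real.exp (2 * s * (timeWeight T t * y)) ≤ T ^ 6 / (2 * m) * (t * (T - t)) := by
  have hw : 0 < t * (T - t) := mul_pos ht.1 (sub_pos.2 ht.2)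
  have hwT : t * (T - t) ≤ T ^ 2 := by
    rw [sq]
    exact mul_le_mul ht.2.le (by linarith [ht.1]) (by linarith [ht.2]) (by linarith [ht.1, ht.2])
  set w := t * (T - t) with hwdef
  have hz : 0 < 2 * m / w ^ 4 := by positivity
  have h1 : 2 * s * (timeWeight T t * y) ≤ -(2 * m / w ^ 4) := by
    have h2 : m ≤ s * -y := by nlinarith
    have h3 : 2 * s * (timeWeight T t * y) = -(2 * (s * -y) / w ^ 4) := by
      rw [timeWeight, ← hwdef]
      ring
    rw [h3]
    gcongr
  calc Real.exp (2 * s * (timeWeight T t * y)) ≤ Real.exp (-(2 * m / w ^ 4)) :=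
        Real.exp_le_exp.2 h1
    _ = (Real.exp (2 * m / w ^ 4))⁻¹ := Real.exp_neg _
    _ ≤ (2 * m / w ^ 4)⁻¹ := by
        gcongr
        linarith [Real.add_one_le_exp (2 * m / w ^ 4)]
    _ = w ^ 3 / (2 * m) * w := by field_simp
    _ ≤ (T ^ 2) ^ 3 / (2 * m) * w := by gcongr
    _ = T ^ 6 / (2 * m) * w := by ring

theorem Degenerate.continuousOn {p : ℝ≥0∞} {x₀ K : ℝ} {a : ℝ → ℝ} (hp : 1 ≤ p)
    (h : Degenerate p x₀ K a) : ContinuousOn a (Icc 0 1) := by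
  obtain ⟨a', ha', -⟩ := h.2.2
  exact ha'.continuousOn hp zero_le_one

theorem Admissible.continuousOn_and_pos {x₀ K₁ K₂ : ℝ} {a b : ℝ → ℝ}
    (h : Admissible x₀ K₁ K₂ a b) :
    (ContinuousOn a (Icc 0 1) ∧ ∀ x ∈ Icc (0 : ℝ) 1, x ≠ x₀ → 0 < a x) ∧
      ContinuousOn b (Icc 0 1) ∧ ∀ x ∈ Icc (0 : ℝ) 1, x ≠ x₀ → 0 < b x := by
  have hW : ∀ {K : ℝ} {a : ℝ → ℝ}, WeaklyDegenerate x₀ K a →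
      ContinuousOn a (Icc 0 1) ∧ ∀ x ∈ Icc (0 : ℝ) 1, x ≠ x₀ → 0 < a x := fun h =>
    ⟨h.2.2.continuousOn le_rfl, h.2.2.2.1⟩
  have hS : ∀ {K : ℝ} {a : ℝ → ℝ}, StronglyDegenerate x₀ K a →
      ContinuousOn a (Icc 0 1) ∧ ∀ x ∈ Icc (0 : ℝ) 1, x ≠ x₀ → 0 < a x := fun h =>
    ⟨h.2.2.continuousOn le_top, h.2.2.2.1⟩
  rcases h with ⟨h, -⟩ | ⟨h, -⟩ | ⟨h | h, -⟩ | ⟨h, -⟩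
  exacts [⟨hW h.1, hW h.2⟩, ⟨hW h.1, hW h.2⟩, ⟨hW h.1, hS h.2⟩, ⟨hS h.1, hW h.2⟩,
    ⟨hS h.1, hS h.2⟩]

/-! ### Local Caccioppoli inequality -/

/-- The Caccioppoli inequality with the weights `t (T - t)` in time and `cutoff α β` in space, on
an interval whose closure stays away from the degeneracy. -/
theorem IsAdjointSolution.lintegral_cutoff_sq_mul_deriv_sq_le {bc : BoundaryKind} {a b : ℝ → ℝ}
    {lam x₀ T α β m Q : ℝ} {v : ℝ → ℝ → ℝ} (hT : 0 < T) (hα : 0 ≤ α) (hαβ : α < β) (hβ : β ≤ 1)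
    (hx₀ : x₀ ∉ Icc α β) (ha : ContinuousOn a (Icc 0 1)) (hb : ContinuousOn b (Icc α β))
    (hb₀ : ∀ x ∈ Icc α β, b x ≠ 0) (hm : 0 < m) (ham : ∀ x ∈ Icc α β, m ≤ a x)
    (hQ : ∀ x ∈ Icc α β, |lam / (a x * b x)| ≤ Q) (hv : IsAdjointSolution bc a b lam x₀ T v) :
    ∫⁻ t in Ioo 0 T, ENNReal.ofReal (t * (T - t)) * ∫⁻ x in Ioo α β, ENNReal.ofReal
        (cutoff α β x ^ 2 * deriv (v t) x ^ 2) ≤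
      ENNReal.ofReal (T * m⁻¹ + T ^ 2 * (4 + 2 * Q)) *
        ∫⁻ t in Ioo 0 T, ∫⁻ x in Ioo α β, ENNReal.ofReal (v t x ^ 2) := by
  obtain ⟨⟨V, hV, hVt⟩, -⟩ := hv
  have hsub : Icc α β ⊆ Icc 0 1 := Icc_subset_Icc hα hβ
  have haI := ha.mono hsub
  have hpos : ∀ x ∈ Icc α β, 0 < a x := fun x hx => hm.trans_le (ham x hx)
  have hpos' : ∀ x ∈ Ioo α β, 0 < a x := fun x hx => hpos x (Ioo_subset_Icc_self hx)
  have hQ₀ : 0 ≤ Q := (abs_nonneg _).trans (hQ α (left_mem_Icc.2 hαβ.le))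
  have cξ := (continuous_cutoff α β).continuousOn (s := Icc α β)
  -- `⟪V, M V⟫` is the energy `∫ ξ² v² / a`, and `⟪V, P V⟫` is `∫_ω v²`.
  obtain ⟨M, hM⟩ := exists_multiplication
    (memLp_top_indicator_Ioo (μ := weightedMeasure a) (ρ := fun x => cutoff α β x ^ 2) (cξ.pow 2))
  obtain ⟨P, hP⟩ := exists_multiplication (memLp_top_indicator_Ioo (μ := weightedMeasure a) haI)
  have hMsymm : ∀ F G, inner ℝ F (M G) = inner ℝ G (M F) := fun F G => by
    rw [inner_multiplication hM (ae_eq_refl F) (ae_eq_refl G),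
      inner_multiplication hM (ae_eq_refl G) (ae_eq_refl F)]
    simp only [mul_comm]
  have hI : ∀ {f : ℝ → ℝ}, ContinuousOn f (Icc α β) → IntegrableOn f (Ioo α β) := fun hf =>
    hf.integrableOn_Icc.mono_set Ioo_subset_Icc_self
  have hslice : ∀ t ∈ Icc 0 T, ContinuousOn (v t) (Icc α β) := fun t ht => by
    obtain ⟨-, v₁, v₂, h, -⟩ := hVt t ht
    exact (h.continuousOn one_le_two zero_le_one).mono hsub
  have eN : ∀ t ∈ Icc 0 T, inner ℝ (V t) (P (V t)) = ∫ x in Ioo α β, v t x ^ 2 := fun t ht => by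
    rw [inner_multiplication hP (hVt t ht).1 (hVt t ht).1,
      integral_weightedMeasure_indicator ha hα hβ hpos']
    refine setIntegral_congr_fun measurableSet_Ioo fun x hx => ?_
    have := (hpos' x hx).ne'
    field_simp
  have eM : ∀ t ∈ Icc 0 T, inner ℝ (V t) (M (V t)) =
      ∫ x in Ioo α β, cutoff α β x ^ 2 * v t x ^ 2 * (1 / a x) := fun t ht => by
    rw [inner_multiplication hM (hVt t ht).1 (hVt t ht).1,
      integral_weightedMeasure_indicator ha hα hβ hpos']
    simp only [sq]
  -- On `[α, β]` the solution is `C¹` in space, so `deriv` is its Sobolev derivative there.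
  have hJ : ∀ t ∈ Icc 0 T, IntegrableOn (fun x => cutoff α β x ^ 2 * deriv (v t) x ^ 2) (Ioo α β) ∧
      ∫ x in Ioo α β, cutoff α β x ^ 2 * deriv (v t) x ^ 2 ≤
      2 * inner ℝ (derivWithin V (Icc 0 T) t) (M (V t)) +
        (4 + 2 * Q) * inner ℝ (V t) (P (V t)) := fun t ht => by
    obtain ⟨hVv, v₁, v₂, h, h₁, -, heq⟩ := hVt t ht
    have hα₁ := h.mono hα hβ
    have h₁' := h₁ α β hαβ.le fun x hx => ⟨hsub hx, fun hxx => hx₀ (hxx ▸ hx)⟩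
    have cv₁ := h₁'.continuousOn one_le_two hαβ.le
    have hder : ∀ x ∈ Ioo α β, cutoff α β x ^ 2 * deriv (v t) x ^ 2 =
        cutoff α β x ^ 2 * v₁ x ^ 2 := fun x hx => by
      rw [(hα₁.hasDerivAt_of_continuousOn one_le_two cv₁ hx).deriv]
    refine ⟨(integrableOn_congr_fun hder measurableSet_Ioo).2 (hI (by fun_prop)), ?_⟩
    rw [setIntegral_congr_fun measurableSet_Ioo hder, eN t ht]
    have hq : ContinuousOn (fun x => lam / (a x * b x)) (Icc α β) :=
      continuousOn_const.div (haI.mul hb) fun x hx => mul_ne_zero (hpos x hx).ne' (hb₀ x hx)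
    refine (integral_cutoff_sq_mul_deriv_sq_le hα hβ hαβ hq
      (fun x hx => hQ x (Ioo_subset_Icc_self hx)) hα₁ h₁').trans_eq ?_
    congr 2
    rw [inner_multiplication hM heq hVv, integral_weightedMeasure_indicator ha hα hβ hpos']
    refine setIntegral_congr_fun measurableSet_Ioo fun x hx => ?_
    have h1 := (hpos' x hx).ne'
    have h2 := hb₀ x (Ioo_subset_Icc_self hx)
    field_simp
  have hmain := lintegral_mul_le_of_le_inner_derivWithin (V := V) (M := M) (P := P)
    (C₀ := 4 + 2 * Q) (C₁ := m⁻¹)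
    (J := fun t => ∫ x in Ioo α β, cutoff α β x ^ 2 * deriv (v t) x ^ 2) hT (by positivity)
    hMsymm hV (fun t _ => integral_nonneg fun x => by positivity) (fun t ht => (hJ t ht).2)
    (fun t ht => by
      rw [eM t ht]
      refine setIntegral_nonneg measurableSet_Ioo fun x hx => ?_
      have := hpos' x hx
      positivity)
    (fun t ht => by
      have cv := hslice t ht
      rw [eM t ht, eN t ht, ← integral_const_mul]
      refine setIntegral_mono_on (hI (((cξ.pow 2).mul (cv.pow 2)).mul
        (continuousOn_const.div haI fun x hx => (hpos x hx).ne'))) ((hI (cv.pow 2)).const_mul _)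
        measurableSet_Ioo fun x hx => ?_
      have hξ := cutoff_le_one hα hβ hx
      have hξ₀ := cutoff_nonneg hx
      have hax := ham x (Ioo_subset_Icc_self hx)
      calc cutoff α β x ^ 2 * v t x ^ 2 * (1 / a x) ≤ 1 * v t x ^ 2 * (1 / m) := by
            have := hm.trans_le hax
            gcongr
            exact pow_le_one₀ hξ₀ hξ
        _ = m⁻¹ * v t x ^ 2 := by ring)
    (fun t ht => by rw [eN t ht]; exact integral_nonneg fun x => by positivity)
  refine le_trans (le_of_eq ?_) (hmain.trans_eq ?_)
  · refine setLIntegral_congr_fun measurableSet_Ioo fun t ht => ?_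
    have ht' := Ioo_subset_Icc_self ht
    rw [ENNReal.ofReal_mul (mul_nonneg ht'.1 (sub_nonneg.2 ht'.2)),
      ofReal_integral_eq_lintegral_ofReal (hJ t ht').1
        (Eventually.of_forall fun x => by simp only [Pi.zero_apply]; positivity)]
  · congr 1
    refine setLIntegral_congr_fun measurableSet_Ioo fun t ht => ?_
    have ht' := Ioo_subset_Icc_self ht
    have hint : IntegrableOn (fun x => v t x ^ 2) (Ioo α β) := hI ((hslice t ht').pow 2)
    rw [eN t ht', ofReal_integral_eq_lintegral_ofReal hint
      (Eventually.of_forall fun x => by simp only [Pi.zero_apply]; positivity)]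

end Caccioppoli

theorem proposition5p3
    -- the degenerate/singular coefficients
    (x₀ K₁ K₂ : ℝ) (hx₀ : x₀ ∈ Ioo (0 : ℝ) 1) (a b : ℝ → ℝ)
    (hab : Caccioppoli.Admissible x₀ K₁ K₂ a b)
    (hweak : Caccioppoli.WWD x₀ K₁ K₂ a b ∨ Caccioppoli.WSD x₀ K₁ K₂ a b →
      Caccioppoli.WeightIdentity x₀ a)
    (lam T : ℝ) (hT : 0 < T) (bc : Caccioppoli.BoundaryKind)
    -- the intervals `ω' = (α', β')` and `ω = (α, β)`
    (α β α' β' : ℝ) (hα : 0 ≤ α) (hαα' : α < α') (hα'β' : α' < β') (hβ'β : β' < β) (hβ : β ≤ 1)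
    (hω : x₀ ∉ closure (Ioo α β))
    -- the space weight
    (Υ : ℝ → ℝ) (c : ℝ) (hΥcont : ContinuousOn Υ (Icc 0 1)) (hΥneg : ∀ x ∈ Icc (0 : ℝ) 1, Υ x < 0)
    (hΥdiff : ContDiffOn ℝ 1 Υ (Icc 0 1 \ {x₀}))
    (hΥderiv : ∀ x ∈ Icc (0 : ℝ) 1 \ {x₀}, |derivWithin Υ (Icc 0 1 \ {x₀}) x| ≤ c / √(a x)) :
    ∃ C C' s₀ : ℝ, 0 < C ∧ 0 < C' ∧ 0 < s₀ ∧
      ∀ v : ℝ → ℝ → ℝ, Caccioppoli.IsAdjointSolution bc a b lam x₀ T v → ∀ s : ℝ, s₀ ≤ s →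
        (∫⁻ t in Ioo 0 T, ∫⁻ x in Ioo α' β', ENNReal.ofReal
            (deriv (v t) x ^ 2 * Real.exp (2 * s * (Caccioppoli.timeWeight T t * Υ x))))
          ≤ ENNReal.ofReal C * ∫⁻ t in Ioo 0 T, ∫⁻ x in Ioo α β, ENNReal.ofReal (v t x ^ 2) ∧
        (ENNReal.ofReal C * ∫⁻ t in Ioo 0 T, ∫⁻ x in Ioo α β, ENNReal.ofReal (v t x ^ 2))
          ≤ ENNReal.ofReal C' *
            ∫⁻ t in Ioo 0 T, ∫⁻ x in Ioo α β, ENNReal.ofReal (v t x ^ 2 * (1 / a x)) := by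

  have hαβ : α < β := hαα'.trans (hα'β'.trans hβ'β)
  rw [closure_Ioo hαβ.ne] at hω
  obtain ⟨⟨ha, ha₀⟩, hb, hb₀⟩ := hab.continuousOn_and_pos
  have hsub : Icc α β ⊆ Icc 0 1 := Icc_subset_Icc hα hβ
  have hne : ∀ x ∈ Icc α β, x ≠ x₀ := fun x hx h => hω (h ▸ hx)
  have haI := ha.mono hsub
  have hapos : ∀ x ∈ Icc α β, 0 < a x := fun x hx => ha₀ x (hsub hx) (hne x hx)
  have hbpos : ∀ x ∈ Icc α β, 0 < b x := fun x hx => hb₀ x (hsub hx) (hne x hx)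
  have hnonempty : (Icc α β).Nonempty := nonempty_Icc.2 hαβ.le
  obtain ⟨xm, hxm, ham⟩ := isCompact_Icc.exists_isMinOn hnonempty haI
  obtain ⟨xM, hxM, haM⟩ := isCompact_Icc.exists_isMaxOn hnonempty haI
  obtain ⟨xΥ, hxΥ, hΥmax⟩ := isCompact_Icc.exists_isMaxOn
    (nonempty_Icc.2 (zero_le_one (α := ℝ))) hΥcont
  obtain ⟨Q, hQ⟩ := isCompact_Icc.exists_bound_of_continuousOn
    (continuousOn_const.div (haI.mul (hb.mono hsub)) fun x hx =>
      (mul_pos (hapos x hx) (hbpos x hx)).ne' :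
        ContinuousOn (fun x => lam / (a x * b x)) (Icc α β))
  have hQ₀ : 0 ≤ Q := (norm_nonneg _).trans (hQ α (left_mem_Icc.2 hαβ.le))
  have hm := hapos xm hxm
  have hμ : 0 < -Υ xΥ := neg_pos.2 (hΥneg xΥ hxΥ)
  -- `δ` bounds the cutoff from below on `(α', β')`.
  set δ := (α' - α) * (β - β') with hδdef
  have hδ : 0 < δ := mul_pos (sub_pos.2 hαα') (sub_pos.2 hβ'β)
  set L := T ^ 6 / (2 * -Υ xΥ) / δ ^ 2 with hLdef
  have hL : 0 < L := by positivity
  set E := T * (a xm)⁻¹ + T ^ 2 * (4 + 2 * Q) with hEdef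
  have hE : 0 < E := by positivity
  have hM := hapos xM hxM
  refine ⟨L * E, L * E * a xM, 1, by positivity, by positivity, one_pos, fun v hv s hs => ⟨?_, ?_⟩⟩
  · have hcacc := hv.lintegral_cutoff_sq_mul_deriv_sq_le hT hα hαβ hβ hω ha (hb.mono hsub)
      (fun x hx => (hbpos x hx).ne') hm (fun x hx => ham hx) hQ
    rw [ENNReal.ofReal_mul hL.le, mul_assoc]
    refine le_trans ?_ (mul_le_mul_right hcacc _)
    rw [← lintegral_const_mul' _ _ ENNReal.ofReal_ne_top]
    refine setLIntegral_mono' measurableSet_Ioo fun t ht => ?_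
    have hw : 0 ≤ t * (T - t) := mul_nonneg ht.1.le (sub_nonneg.2 ht.2.le)
    rw [← mul_assoc, ← ENNReal.ofReal_mul hL.le,
      ← lintegral_const_mul' _ _ ENNReal.ofReal_ne_top]
    refine (setLIntegral_mono' measurableSet_Ioo fun x hx => ?_).trans
      (lintegral_mono_set (Ioo_subset_Ioo hαα'.le hβ'β.le))
    rw [← ENNReal.ofReal_mul (mul_nonneg hL.le hw)]
    refine ENNReal.ofReal_le_ofReal ?_
    have hx1 : x ∈ Icc (0 : ℝ) 1 := hsub ⟨(hαα'.trans hx.1).le, (hx.2.trans hβ'β).le⟩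
    have hexp := Caccioppoli.exp_timeWeight_le hμ
      (show Υ x ≤ - -Υ xΥ by rw [neg_neg]; exact hΥmax hx1) hs ht
    have hξ : δ ^ 2 ≤ Caccioppoli.cutoff α β x ^ 2 := by
      refine pow_le_pow_left₀ hδ.le (mul_le_mul ?_ ?_ ?_ ?_) 2 <;> linarith [hx.1, hx.2]
    calc deriv (v t) x ^ 2 * Real.exp (2 * s * (Caccioppoli.timeWeight T t * Υ x))
        ≤ deriv (v t) x ^ 2 * (T ^ 6 / (2 * -Υ xΥ) * (t * (T - t))) := by gcongr
      _ = L * (t * (T - t)) * (δ ^ 2 * deriv (v t) x ^ 2) := by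
          rw [hLdef]
          field_simp
      _ ≤ L * (t * (T - t)) * (Caccioppoli.cutoff α β x ^ 2 * deriv (v t) x ^ 2) := by gcongr
  · rw [ENNReal.ofReal_mul (by positivity : 0 ≤ L * E), mul_assoc]
    refine mul_le_mul_right ?_ _
    rw [← lintegral_const_mul' _ _ ENNReal.ofReal_ne_top]
    refine lintegral_mono fun t => ?_
    rw [← lintegral_const_mul' _ _ ENNReal.ofReal_ne_top]
    refine setLIntegral_mono' measurableSet_Ioo fun x hx => ?_
    rw [← ENNReal.ofReal_mul hM.le]
    refine ENNReal.ofReal_le_ofReal ?_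
    have hx' := Ioo_subset_Icc_self hx
    have hax := hapos x hx'
    have hle : 1 ≤ a xM / a x := (one_le_div hax).2 (haM hx')
    calc v t x ^ 2 = v t x ^ 2 * 1 := (mul_one _).symm
      _ ≤ v t x ^ 2 * (a xM / a x) := by gcongr
      _ = a xM * (v t x ^ 2 * (1 / a x)) := by ring
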